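/- **Proposition 3.6.** Let $\mathcal H$ be a complex Hilbert space with orthonormal basis $\{e_k : k\in\mathbb Z\}$, with symplectic form $\sigma(x,y)=\operatorname{Im}\langle x,y\rangle$ (inner product linear in the first variable), and let $\mathrm{CCR}(\mathcal H)$ be the universal unital $C^*$-algebra generated by elements $W(x)$, $x\in\mathcal H$, with unit $W(0)$, such that $W(x)^*=W(-x)$ and $W(x)W(y)=e^{i\sigma(x,y)}W(x+y)$. Let $\mathfrak A=\mathrm{CCR}(\mathbb C)$, with $\sigma(z,w)=\operatorname{Im}(z\bar w)$, and let $\mathfrak B_0\subset\mathrm{CCR}(\mathcal H)$ be the $C^*$-subalgebra generated by the $W(x)$ with $x$ in the linear span of $\{e_k : k\in\mathbb Z\}$; it is identified with $\bigotimes_{\mathbb Z}\mathfrak A$ through the embeddings $i_k:\mathfrak A\to\mathfrak B_0$, $i_k(W(z))=W(ze_k)$. Let $\mathbb O_{\mathbb Z}$ be the group of unitaries $O$ of $\mathcal H$ with $Oe_i=e_i$ for all but finitely many $i$ and with all matrix entries $\langle Oe_i,e_j\rangle$ real; it acts on $\mathfrak B_0$ by $\rho_O(W(x))=W(Ox)$.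 A state $\omega$ on $\mathfrak B_0$ is *rotatable* if $\omega\circ\rho_O=\omega$ for all $O\in\mathbb O_{\mathbb Z}$. Let $\varphi$ be a state on $\mathfrak A$ and set $G_\varphi(z)=\varphi(W(z))$, $z\in\mathbb C$. Let $\omega=\bigotimes_{\mathbb Z}\varphi$ be the product state on $\mathfrak B_0$, i.e. $\omega(i_{k_1}(a_1)\cdots i_{k_n}(a_n))=\varphi(a_1)\cdots\varphi(a_n)$ for all distinct $k_1,\dots,k_n\in\mathbb Z$ and all $a_1,\dots,a_n\in\mathfrak A$. If $\omega$ is rotatable, then either $G_\varphi(t)=\mathbb 1_{\{0\}}(t)$ for all $t\in\mathbb R$, or there exists $\sigma^2\ge 0$ such that $$G_\varphi(t)=e^{-\frac{\sigma^2t^2}{2}},\qquad t\in\mathbb R.$$ -/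

import Mathlib

open scoped ComplexOrder

set_option linter.unusedSectionVars false

noncomputable section

namespace Weyl

universe u v

/-! ## The Weyl `*`-algebra of a complex inner product space -/

section Algebra

variable {E : Type u} [NormedAddCommGroup E] [InnerProductSpace ℂ E]

/-- The canonical symplectic form `σ(x, y) = Im ⟨x, y⟩`, for the inner product that is linear in
the first variable. Mathlib's `inner ℂ` is linear in the second variable, whence the swap.
On `E = ℂ` this is `Im (x * conj y)`. -/
def sympl (x y : E) : ℝ := (inner ℂ y x).im

/-- The phase `exp (i σ(x, y))`. -/
def phase (x y : E) : ℂ := Complex.exp (Complex.I * (sympl x y : ℂ))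

theorem sympl_complex (z w : ℂ) : sympl z w = (z * (starRingEnd ℂ) w).im := by
  simp [sympl, RCLike.inner_apply]

theorem sympl_swap (x y : E) : sympl y x = -sympl x y := by
  unfold sympl
  rw [← inner_conj_symm x y, Complex.conj_im]

theorem sympl_self (x : E) : sympl x x = 0 := by
  have h := sympl_swap x x
  linarith

theorem sympl_add_left (x y z : E) : sympl (x + y) z = sympl x z + sympl y z := by
  simp [sympl]

theorem sympl_add_right (x y z : E) : sympl x (y + z) = sympl x y + sympl x z := by
  simp [sympl]

theorem sympl_neg_left (x y : E) : sympl (-x) y = -sympl x y := by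
  simp [sympl, inner_neg_right]

theorem sympl_neg_right (x y : E) : sympl x (-y) = -sympl x y := by
  simp [sympl, inner_neg_left]

theorem sympl_zero_left (x : E) : sympl 0 x = 0 := by simp [sympl]

theorem sympl_zero_right (x : E) : sympl x 0 = 0 := by simp [sympl]

theorem phase_cocycle (x y z : E) :
    phase x y * phase (x + y) z = phase y z * phase x (y + z) := by
  unfold phase
  rw [← Complex.exp_add, ← Complex.exp_add, sympl_add_left, sympl_add_right]
  congr 1
  push_cast
  ring

theorem conj_phase (x y : E) : (starRingEnd ℂ) (phase x y) = phase (-y) (-x) := by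
  unfold phase
  rw [← Complex.exp_conj, sympl_neg_left, sympl_neg_right, sympl_swap x y]
  simp

theorem phase_zero_left (x : E) : phase 0 x = 1 := by simp [phase, sympl_zero_left]

theorem phase_zero_right (x : E) : phase x 0 = 1 := by simp [phase, sympl_zero_right]

theorem phase_neg_self (x : E) : phase (-x) x = 1 := by
  simp [phase, sympl_neg_left, sympl_self]

variable (E) in
/-- The Weyl `*`-algebra: the complex vector space with basis the symbols `W(x)`, `x ∈ E`, with
the product and the involution given by the canonical commutation rules
`W(x) W(y) = exp(i σ(x, y)) W(x + y)` and `W(x)* = W(-x)`. -/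
def Alg : Type u := E →₀ ℂ

instance : AddCommGroup (Alg E) := inferInstanceAs (AddCommGroup (E →₀ ℂ))

instance : Module ℂ (Alg E) := inferInstanceAs (Module ℂ (E →₀ ℂ))

/-- The basis element `W(x)` of the Weyl `*`-algebra. -/
def Alg.W (x : E) : Alg E := Finsupp.single x (1 : ℂ)

/-- The linear map out of the Weyl algebra with prescribed values on the basis `W(x)`. -/
def Alg.linLift {M : Type*} [AddCommGroup M] [Module ℂ M] (f : E → M) : Alg E →ₗ[ℂ] M :=
  Finsupp.lift M ℂ E f

theorem Alg.linLift_W {M : Type*} [AddCommGroup M] [Module ℂ M] (f : E → M) (x : E) :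
    Alg.linLift f (Alg.W x) = f x := by
  change Finsupp.lift M ℂ E f (Finsupp.single x (1 : ℂ)) = f x
  rw [Finsupp.lift_apply, Finsupp.sum_single_index] <;> simp

theorem Alg.induction {P : Alg E → Prop} (a : Alg E) (h0 : P 0)
    (hadd : ∀ a b, P a → P b → P (a + b)) (hW : ∀ (c : ℂ) (x : E), P (c • Alg.W x)) : P a := by
  refine Finsupp.induction_linear (motive := P) a h0 hadd fun x c => ?_
  have h : (Finsupp.single x c : E →₀ ℂ) = c • Finsupp.single x (1 : ℂ) := by simp
  rw [h]
  exact hW c x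

/-- The bilinear extension of `W(x) W(y) = exp(i σ(x, y)) W(x + y)`. -/
def Alg.mulL : Alg E →ₗ[ℂ] Alg E →ₗ[ℂ] Alg E :=
  Alg.linLift fun x => Alg.linLift fun y => phase x y • Alg.W (x + y)

/-- The conjugate-linear extension of `W(x)* = W(-x)`. -/
def Alg.starAdd : Alg E →+ Alg E :=
  Finsupp.liftAddHom (M := ℂ) (N := E →₀ ℂ) fun x : E =>
    (Finsupp.singleAddHom (-x)).comp (starRingEnd ℂ).toAddMonoidHom

instance : Mul (Alg E) := ⟨fun a b => Alg.mulL a b⟩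

instance : One (Alg E) := ⟨Alg.W 0⟩

instance : Star (Alg E) := ⟨fun a => Alg.starAdd a⟩

theorem Alg.mul_def (a b : Alg E) : a * b = Alg.mulL a b := rfl

theorem Alg.one_def : (1 : Alg E) = Alg.W 0 := rfl

theorem Alg.W_mul (x y : E) : Alg.W x * Alg.W y = phase x y • Alg.W (x + y) := by
  simp [Alg.mul_def, Alg.mulL, Alg.linLift_W]

theorem Alg.smul_mul' (c : ℂ) (a b : Alg E) : c • a * b = c • (a * b) := by
  simp [Alg.mul_def]

theorem Alg.mul_smul' (c : ℂ) (a b : Alg E) : a * c • b = c • (a * b) := by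
  simp [Alg.mul_def]

theorem Alg.add_mul' (a b c : Alg E) : (a + b) * c = a * c + b * c := by
  simp [Alg.mul_def]

theorem Alg.mul_add' (a b c : Alg E) : a * (b + c) = a * b + a * c := by
  simp [Alg.mul_def]

theorem Alg.zero_mul' (a : Alg E) : 0 * a = 0 := by simp [Alg.mul_def]

theorem Alg.mul_zero' (a : Alg E) : a * 0 = 0 := by simp [Alg.mul_def]

theorem Alg.star_smul_W (c : ℂ) (x : E) :
    star (c • Alg.W x) = (starRingEnd ℂ) c • Alg.W (-x) := by
  change Finsupp.liftAddHom (M := ℂ) (N := E →₀ ℂ) (fun x : E =>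
    (Finsupp.singleAddHom (-x)).comp (starRingEnd ℂ).toAddMonoidHom)
      (c • Finsupp.single x (1 : ℂ)) = (starRingEnd ℂ) c • Finsupp.single (-x) (1 : ℂ)
  rw [Finsupp.smul_single, Finsupp.smul_single, Finsupp.liftAddHom_apply_single]
  simp

theorem Alg.star_W (x : E) : star (Alg.W x) = Alg.W (-x) := by
  simpa using Alg.star_smul_W 1 x

theorem Alg.star_add' (a b : Alg E) : star (a + b) = star a + star b :=
  map_add Alg.starAdd a b

theorem Alg.star_zero' : star (0 : Alg E) = 0 := map_zero Alg.starAdd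

instance : Ring (Alg E) where
  __ := (inferInstance : AddCommGroup (Alg E))
  left_distrib := Alg.mul_add'
  right_distrib := Alg.add_mul'
  zero_mul := Alg.zero_mul'
  mul_zero := Alg.mul_zero'
  mul_assoc a b c := by
    induction a using Alg.induction with
    | h0 => simp only [Alg.zero_mul']
    | hadd a a' h h' => simp only [Alg.add_mul', h, h']
    | hW r x =>
      induction b using Alg.induction with
      | h0 => simp only [Alg.zero_mul', Alg.mul_zero']
      | hadd b b' h h' => simp only [Alg.add_mul', Alg.mul_add', h, h']
      | hW s y =>
        induction c using Alg.induction with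
        | h0 => simp only [Alg.mul_zero']
        | hadd c c' h h' => simp only [Alg.mul_add', h, h']
        | hW t z =>
          simp only [Alg.smul_mul', Alg.mul_smul', Alg.W_mul, smul_smul, add_assoc]
          congr 1
          linear_combination (t * (s * r)) * phase_cocycle x y z
  one_mul a := by
    induction a using Alg.induction with
    | h0 => simp only [Alg.mul_zero']
    | hadd a a' h h' => simp only [Alg.mul_add', h, h']
    | hW r x => simp [Alg.one_def, Alg.mul_smul', Alg.W_mul, phase_zero_left]
  mul_one a := by
    induction a using Alg.induction with
    | h0 => simp only [Alg.zero_mul']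
    | hadd a a' h h' => simp only [Alg.add_mul', h, h']
    | hW r x => simp [Alg.one_def, Alg.smul_mul', Alg.W_mul, phase_zero_right]

instance : Algebra ℂ (Alg E) := Algebra.ofModule Alg.smul_mul' Alg.mul_smul'

instance : StarRing (Alg E) where
  star_involutive a := by
    induction a using Alg.induction with
    | h0 => simp only [Alg.star_zero']
    | hadd a a' h h' => simp only [Alg.star_add', h, h']
    | hW r x => simp [Alg.star_smul_W]
  star_mul a b := by
    induction a using Alg.induction with
    | h0 => simp only [zero_mul, mul_zero, Alg.star_zero']
    | hadd a a' h h' => simp only [add_mul, mul_add, Alg.star_add', h, h']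
    | hW r x =>
      induction b using Alg.induction with
      | h0 => simp only [zero_mul, mul_zero, Alg.star_zero']
      | hadd b b' h h' => simp only [add_mul, mul_add, Alg.star_add', h, h']
      | hW s y =>
        simp only [smul_mul_assoc, mul_smul_comm, Alg.W_mul, smul_smul, Alg.star_smul_W,
          map_mul, conj_phase]
        rw [neg_add_rev]
        congr 1
        ring
  star_add := Alg.star_add'

instance : StarModule ℂ (Alg E) where
  star_smul c a := by
    induction a using Alg.induction with
    | h0 => simp
    | hadd a a' h h' => rw [smul_add, star_add, h, h', star_add, smul_add]
    | hW r x =>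
      rw [smul_smul, Alg.star_smul_W, Alg.star_smul_W, smul_smul, map_mul]
      rfl

/-! ## The maximal C*-seminorm -/

/-- A C*-seminorm on a complex `*`-algebra. -/
structure CStarSeminorm (A : Type*) [Ring A] [StarRing A] [Algebra ℂ A] extends Seminorm ℂ A where
  mul_le' : ∀ a b : A, toFun (a * b) ≤ toFun a * toFun b
  star_mul_self' : ∀ a : A, toFun (star a * a) = toFun a ^ 2

namespace CStarSeminorm

variable {A : Type*} [Ring A] [StarRing A] [Algebra ℂ A] (p : CStarSeminorm A)

theorem mul_le (a b : A) : p.toSeminorm (a * b) ≤ p.toSeminorm a * p.toSeminorm b :=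
  p.mul_le' a b

theorem star_mul_self (a : A) : p.toSeminorm (star a * a) = p.toSeminorm a ^ 2 :=
  p.star_mul_self' a

theorem one_le_one : p.toSeminorm 1 ≤ 1 := by
  have h := p.star_mul_self 1
  simp only [star_one, mul_one] at h
  nlinarith [apply_nonneg p.toSeminorm 1]

theorem le_star (a : A) : p.toSeminorm a ≤ p.toSeminorm (star a) := by
  have h := p.star_mul_self a
  have h2 := p.mul_le (star a) a
  have h3 := apply_nonneg p.toSeminorm a
  have h4 := apply_nonneg p.toSeminorm (star a)
  by_contra! hlt
  nlinarith

theorem star_eq (a : A) : p.toSeminorm (star a) = p.toSeminorm a := by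
  refine le_antisymm ?_ (p.le_star a)
  simpa using p.le_star (star a)

instance : Nonempty (CStarSeminorm A) :=
  ⟨{ (0 : Seminorm ℂ A) with
      mul_le' := fun _ _ => by
        change (0 : ℝ) ≤ 0 * 0
        simp
      star_mul_self' := fun _ => by
        change (0 : ℝ) = 0 ^ 2
        simp }⟩

end CStarSeminorm

theorem Alg.seminorm_W_le (p : CStarSeminorm (Alg E)) (x : E) :
    p.toSeminorm (Alg.W x) ≤ 1 := by
  have h := p.star_mul_self (Alg.W x)
  rw [Alg.star_W, Alg.W_mul, phase_neg_self, one_smul, neg_add_cancel, ← Alg.one_def] at h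
  have h1 := p.one_le_one
  nlinarith [apply_nonneg p.toSeminorm (Alg.W x)]

theorem Alg.bddAbove (a : Alg E) :
    BddAbove (Set.range fun p : CStarSeminorm (Alg E) => p.toSeminorm a) := by
  induction a using Alg.induction with
  | h0 => exact ⟨0, by rintro _ ⟨p, rfl⟩; simp⟩
  | hadd a b ha hb =>
    obtain ⟨A, hA⟩ := ha
    obtain ⟨B, hB⟩ := hb
    refine ⟨A + B, ?_⟩
    rintro _ ⟨p, rfl⟩
    exact (map_add_le_add p.toSeminorm a b).trans (add_le_add (hA ⟨p, rfl⟩) (hB ⟨p, rfl⟩))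
  | hW c x =>
    refine ⟨‖c‖, ?_⟩
    rintro _ ⟨p, rfl⟩
    change p.toSeminorm (c • Alg.W x) ≤ ‖c‖
    rw [map_smul_eq_mul]
    exact mul_le_of_le_one_right (norm_nonneg c) (Alg.seminorm_W_le p x)

/-- The largest C*-seminorm on the Weyl `*`-algebra. -/
def Alg.maxNorm (a : Alg E) : ℝ := ⨆ p : CStarSeminorm (Alg E), p.toSeminorm a

theorem Alg.le_maxNorm (p : CStarSeminorm (Alg E)) (a : Alg E) : p.toSeminorm a ≤ Alg.maxNorm a :=
  le_ciSup (Alg.bddAbove a) p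

theorem Alg.maxNorm_le {a : Alg E} {r : ℝ}
    (h : ∀ p : CStarSeminorm (Alg E), p.toSeminorm a ≤ r) : Alg.maxNorm a ≤ r :=
  ciSup_le h

theorem Alg.maxNorm_nonneg (a : Alg E) : 0 ≤ Alg.maxNorm a :=
  Real.iSup_nonneg fun p => apply_nonneg p.toSeminorm a

theorem Alg.maxNorm_star (a : Alg E) : Alg.maxNorm (star a) = Alg.maxNorm a := by
  simp only [Alg.maxNorm, CStarSeminorm.star_eq]

theorem Alg.maxNorm_mul_le (a b : Alg E) :
    Alg.maxNorm (a * b) ≤ Alg.maxNorm a * Alg.maxNorm b :=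
  Alg.maxNorm_le fun p => (p.mul_le a b).trans
    (mul_le_mul (Alg.le_maxNorm p a) (Alg.le_maxNorm p b) (apply_nonneg _ _)
      (Alg.maxNorm_nonneg a))

theorem Alg.maxNorm_mul_self_le (a : Alg E) :
    Alg.maxNorm a * Alg.maxNorm a ≤ Alg.maxNorm (star a * a) := by
  have h : Alg.maxNorm a ≤ √(Alg.maxNorm (star a * a)) := by
    refine Alg.maxNorm_le fun p => Real.le_sqrt_of_sq_le ?_
    rw [← p.star_mul_self]
    exact Alg.le_maxNorm p _
  calc Alg.maxNorm a * Alg.maxNorm a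
      ≤ √(Alg.maxNorm (star a * a)) * √(Alg.maxNorm (star a * a)) :=
        mul_self_le_mul_self (Alg.maxNorm_nonneg a) h
    _ = Alg.maxNorm (star a * a) := Real.mul_self_sqrt (Alg.maxNorm_nonneg _)

theorem Alg.maxNorm_smul_le (c : ℂ) (a : Alg E) : Alg.maxNorm (c • a) ≤ ‖c‖ * Alg.maxNorm a :=
  Alg.maxNorm_le fun p => by
    rw [map_smul_eq_mul]
    exact mul_le_mul_of_nonneg_left (Alg.le_maxNorm p a) (norm_nonneg c)

/-- The largest C*-seminorm as a seminorm of the additive group. -/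
def Alg.groupSeminorm : AddGroupSeminorm (Alg E) where
  toFun := Alg.maxNorm
  map_zero' := le_antisymm (Alg.maxNorm_le fun p => by simp) (Alg.maxNorm_nonneg 0)
  add_le' a b := Alg.maxNorm_le fun p => (map_add_le_add p.toSeminorm a b).trans
    (add_le_add (Alg.le_maxNorm p a) (Alg.le_maxNorm p b))
  neg' a := by simp only [Alg.maxNorm, map_neg_eq_map]

instance : SeminormedRing (Alg E) where
  __ := (inferInstance : Ring (Alg E))
  __ := AddGroupSeminorm.toSeminormedAddCommGroup Alg.groupSeminorm
  norm_mul_le := Alg.maxNorm_mul_le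

theorem Alg.norm_def (a : Alg E) : ‖a‖ = Alg.maxNorm a := rfl

instance : NormedAlgebra ℂ (Alg E) where
  norm_smul_le := Alg.maxNorm_smul_le

instance : NormedStarGroup (Alg E) where
  norm_star_le a := (Alg.maxNorm_star a).le

end Algebra

/-! ## Completion of a `*`-algebra with a C*-seminorm -/

section Completion

open UniformSpace

variable {A : Type u} [SeminormedRing A] [StarRing A] [NormedStarGroup A]
  [NormedAlgebra ℂ A] [StarModule ℂ A]

theorem uniformContinuous_star' : UniformContinuous (star : A → A) :=
  (AddMonoidHomClass.isometry_of_norm (starAddEquiv : A ≃+ A)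
    (fun a => norm_star a)).uniformContinuous

theorem continuous_completion_smul (c : ℂ) : Continuous fun a : Completion A => c • a :=
  (uniformContinuous_const_smul c).continuous

/-- The continuous extension of the involution to the completion. -/
def completionStar (a : Completion A) : Completion A := Completion.map (star : A → A) a

theorem continuous_completionStar : Continuous (completionStar : Completion A → Completion A) :=
  Completion.continuous_map

theorem completionStar_coe (a : A) :
    completionStar (a : Completion A) = ((star a : A) : Completion A) :=
  Completion.map_coe uniformContinuous_star' a

theorem completion_norm_smul_le (c : ℂ) (a : Completion A) : ‖c • a‖ ≤ ‖c‖ * ‖a‖ :=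
  Completion.induction_on a
    (isClosed_le (continuous_completion_smul c).norm (continuous_norm.const_mul _)) fun a => by
      rw [← Completion.coe_smul, Completion.norm_coe, Completion.norm_coe]
      exact norm_smul_le c a

theorem completionStar_star (a : Completion A) : completionStar (completionStar a) = a :=
  Completion.induction_on a
    (isClosed_eq (continuous_completionStar.comp continuous_completionStar) continuous_id)
    fun a => by rw [completionStar_coe, completionStar_coe, star_star]

theorem completionStar_mul (a b : Completion A) :
    completionStar (a * b) = completionStar b * completionStar a :=
  Completion.induction_on₂ a b
    (isClosed_eq (continuous_completionStar.comp continuous_mul)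
      ((continuous_completionStar.comp continuous_snd).mul
        (continuous_completionStar.comp continuous_fst)))
    fun a b => by
      rw [← Completion.coe_mul, completionStar_coe, completionStar_coe, completionStar_coe,
        ← Completion.coe_mul, star_mul]

theorem completionStar_add (a b : Completion A) :
    completionStar (a + b) = completionStar a + completionStar b :=
  Completion.induction_on₂ a b
    (isClosed_eq (continuous_completionStar.comp continuous_add)
      ((continuous_completionStar.comp continuous_fst).add
        (continuous_completionStar.comp continuous_snd)))
    fun a b => by
      rw [← Completion.coe_add, completionStar_coe, completionStar_coe, completionStar_coe,
        ← Completion.coe_add, star_add]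

theorem completionStar_smul (c : ℂ) (a : Completion A) :
    completionStar (c • a) = star c • completionStar a :=
  Completion.induction_on a
    (isClosed_eq (continuous_completionStar.comp (continuous_completion_smul c))
      ((continuous_completion_smul (star c)).comp continuous_completionStar))
    fun a => by
      rw [← Completion.coe_smul, completionStar_coe, completionStar_coe,
        ← Completion.coe_smul, star_smul]

theorem completion_norm_mul_self_le (hA : ∀ a : A, ‖a‖ * ‖a‖ ≤ ‖star a * a‖) (a : Completion A) :
    ‖a‖ * ‖a‖ ≤ ‖completionStar a * a‖ :=
  Completion.induction_on a
    (isClosed_le (continuous_norm.mul continuous_norm)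
      (continuous_completionStar.mul continuous_id).norm)
    fun a => by
      rw [completionStar_coe, ← Completion.coe_mul, Completion.norm_coe, Completion.norm_coe]
      exact hA a

/-- The completion of a `*`-algebra with a C*-seminorm is a C*-algebra, with the continuous
extensions of the operations. -/
def completionCStarAlgebra (hA : ∀ a : A, ‖a‖ * ‖a‖ ≤ ‖star a * a‖) :
    CStarAlgebra (Completion A) :=
  { (inferInstance : NormedRing (Completion A)),
    (inferInstance : Algebra ℂ (Completion A)),
    (inferInstance : CompleteSpace (Completion A)) with
    star := completionStar
    norm_smul_le := completion_norm_smul_le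
    star_involutive := completionStar_star
    star_mul := completionStar_mul
    star_add := completionStar_add
    norm_mul_self_le := completion_norm_mul_self_le hA
    star_smul := completionStar_smul }

end Completion

/-! ## The CCR algebra -/

section CCR

open UniformSpace

variable (E : Type u) [NormedAddCommGroup E] [InnerProductSpace ℂ E]

/-- The CCR algebra of `E`: the universal C*-algebra generated by the `W(x)` subject to the
canonical commutation rules, that is, the (separated) completion of the Weyl `*`-algebra with
respect to its largest C*-seminorm. -/
def CCR : Type u := Completion (Alg E)

instance : CStarAlgebra (CCR E) := completionCStarAlgebra (A := Alg E) Alg.maxNorm_mul_self_le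

variable {E}

/-- The canonical map from the Weyl `*`-algebra to the CCR algebra. -/
def CCR.of (a : Alg E) : CCR E := (a : Completion (Alg E))

theorem CCR.norm_of (a : Alg E) : ‖CCR.of a‖ = ‖a‖ := Completion.norm_coe a

theorem CCR.of_add (a b : Alg E) : CCR.of (a + b) = CCR.of a + CCR.of b := Completion.coe_add a b

theorem CCR.of_mul (a b : Alg E) : CCR.of (a * b) = CCR.of a * CCR.of b := Completion.coe_mul a b

theorem CCR.of_smul (c : ℂ) (a : Alg E) : CCR.of (c • a) = c • CCR.of a := Completion.coe_smul c a

theorem CCR.of_zero : CCR.of (0 : Alg E) = 0 := Completion.coe_zero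

theorem CCR.of_one : CCR.of (1 : Alg E) = 1 := Completion.coe_one _

theorem CCR.of_star (a : Alg E) : CCR.of (star a) = star (CCR.of a) :=
  (completionStar_coe a).symm

theorem CCR.induction {P : CCR E → Prop} (a : CCR E) (hc : IsClosed {a | P a})
    (h : ∀ a : Alg E, P (CCR.of a)) : P a :=
  Completion.induction_on (p := P) a hc h

/-- The Weyl unitaries `W(x)` of the CCR algebra. -/
def W (x : E) : CCR E := CCR.of (Alg.W x)

theorem W_mul (x y : E) : W x * W y = phase x y • W (x + y) := by
  rw [W, W, ← CCR.of_mul, Alg.W_mul, CCR.of_smul, W]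

theorem star_W (x : E) : star (W x) = W (-x) := by
  rw [W, ← CCR.of_star, Alg.star_W, W]

theorem W_zero : (W 0 : CCR E) = 1 := CCR.of_one

/-- A closed `*`-subalgebra containing all the `W(x)` is everything. -/
theorem CCR.mem_of_W_mem (T : StarSubalgebra ℂ (CCR E)) (hT : IsClosed (T : Set (CCR E)))
    (h : ∀ x : E, W x ∈ T) (a : CCR E) : a ∈ T := by
  induction a using CCR.induction with
  | hc => exact hT
  | h a =>
    induction a using Alg.induction with
    | h0 => rw [CCR.of_zero]; exact zero_mem T
    | hadd a b ha hb => rw [CCR.of_add]; exact add_mem ha hb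
    | hW c x => rw [CCR.of_smul]; exact T.smul_mem (h x) c

/-! ### The universal property -/

/-- A family of elements of a unital C*-algebra that satisfies the canonical commutation rules. -/
structure IsWeylSystem {B : Type v} [CStarAlgebra B] (V : E → B) : Prop where
  map_zero : V 0 = 1
  star_eq : ∀ x, star (V x) = V (-x)
  mul_eq : ∀ x y, V x * V y = phase x y • V (x + y)

theorem isWeylSystem_W : IsWeylSystem (W : E → CCR E) := ⟨W_zero, star_W, W_mul⟩

variable {B : Type v} [CStarAlgebra B] {V : E → B}

theorem linLift_mul (hV : IsWeylSystem V) (a b : Alg E) :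
    Alg.linLift V (a * b) = Alg.linLift V a * Alg.linLift V b := by
  induction a using Alg.induction with
  | h0 => simp
  | hadd a a' h h' => simp only [add_mul, map_add, h, h']
  | hW r x =>
    induction b using Alg.induction with
    | h0 => simp
    | hadd b b' h h' => simp only [mul_add, map_add, h, h']
    | hW s y =>
      simp only [smul_mul_assoc, mul_smul_comm, Alg.W_mul, map_smul, Alg.linLift_W, hV.mul_eq]

theorem linLift_star (hV : IsWeylSystem V) (a : Alg E) :
    Alg.linLift V (star a) = star (Alg.linLift V a) := by
  induction a using Alg.induction with
  | h0 => simp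
  | hadd a a' h h' => simp only [star_add, map_add, h, h']
  | hW r x => simp [Alg.star_W, Alg.linLift_W, hV.star_eq]

theorem linLift_norm_le (hV : IsWeylSystem V) (a : Alg E) : ‖Alg.linLift V a‖ ≤ ‖a‖ :=
  Alg.le_maxNorm (E := E)
    { (normSeminorm ℂ B).comp (Alg.linLift V) with
      mul_le' := fun a b => by
        change ‖Alg.linLift V (a * b)‖ ≤ ‖Alg.linLift V a‖ * ‖Alg.linLift V b‖
        rw [linLift_mul hV]
        exact norm_mul_le _ _
      star_mul_self' := fun a => by
        change ‖Alg.linLift V (star a * a)‖ = ‖Alg.linLift V a‖ ^ 2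
        rw [linLift_mul hV, linLift_star hV, CStarRing.norm_star_mul_self, sq] } a

theorem linLift_uniformContinuous (hV : IsWeylSystem V) :
    UniformContinuous (Alg.linLift V : Alg E → B) :=
  (AddMonoidHomClass.lipschitz_of_bound (Alg.linLift V) 1
    (fun a => by simpa using linLift_norm_le hV a)).uniformContinuous

/-- The underlying function of the `*`-homomorphism induced by a Weyl system. -/
def CCR.liftFun (V : E → B) : CCR E → B :=
  Completion.extension (Alg.linLift V : Alg E → B)

theorem CCR.liftFun_of (hV : IsWeylSystem V) (a : Alg E) :
    CCR.liftFun V (CCR.of a) = Alg.linLift V a :=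
  Completion.extension_coe (linLift_uniformContinuous hV) a

theorem CCR.continuous_liftFun : Continuous (CCR.liftFun V : CCR E → B) :=
  Completion.continuous_extension

theorem CCR.liftFun_add (hV : IsWeylSystem V) (a b : CCR E) :
    CCR.liftFun V (a + b) = CCR.liftFun V a + CCR.liftFun V b := by
  have hc := CCR.continuous_liftFun (V := V)
  induction a using CCR.induction with
  | hc =>
    exact isClosed_eq (hc.comp (continuous_id.add continuous_const)) (hc.add continuous_const)
  | h a =>
    induction b using CCR.induction with
    | hc =>
      exact isClosed_eq (hc.comp (continuous_const.add continuous_id)) (continuous_const.add hc)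
    | h b => rw [← CCR.of_add, CCR.liftFun_of hV, CCR.liftFun_of hV, CCR.liftFun_of hV, map_add]

theorem CCR.liftFun_mul (hV : IsWeylSystem V) (a b : CCR E) :
    CCR.liftFun V (a * b) = CCR.liftFun V a * CCR.liftFun V b := by
  have hc := CCR.continuous_liftFun (V := V)
  induction a using CCR.induction with
  | hc =>
    exact isClosed_eq (hc.comp (continuous_id.mul continuous_const)) (hc.mul continuous_const)
  | h a =>
    induction b using CCR.induction with
    | hc =>
      exact isClosed_eq (hc.comp (continuous_const.mul continuous_id)) (continuous_const.mul hc)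
    | h b =>
      rw [← CCR.of_mul, CCR.liftFun_of hV, CCR.liftFun_of hV, CCR.liftFun_of hV, linLift_mul hV]

theorem CCR.liftFun_smul (hV : IsWeylSystem V) (c : ℂ) (a : CCR E) :
    CCR.liftFun V (c • a) = c • CCR.liftFun V a := by
  have hc := CCR.continuous_liftFun (V := V)
  induction a using CCR.induction with
  | hc => exact isClosed_eq (hc.comp (continuous_const_smul c)) (hc.const_smul c)
  | h a => rw [← CCR.of_smul, CCR.liftFun_of hV, CCR.liftFun_of hV, map_smul]

theorem CCR.liftFun_star (hV : IsWeylSystem V) (a : CCR E) :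
    CCR.liftFun V (star a) = star (CCR.liftFun V a) := by
  have hc := CCR.continuous_liftFun (V := V)
  induction a using CCR.induction with
  | hc => exact isClosed_eq (hc.comp continuous_star) hc.star
  | h a => rw [← CCR.of_star, CCR.liftFun_of hV, CCR.liftFun_of hV, linLift_star hV]

theorem CCR.liftFun_one (hV : IsWeylSystem V) : CCR.liftFun V (1 : CCR E) = 1 := by
  rw [← CCR.of_one, CCR.liftFun_of hV, Alg.one_def, Alg.linLift_W, hV.map_zero]

/-- The `*`-homomorphism `CCR(E) → B`, `W(x) ↦ V(x)`, induced by a Weyl system `V` in a unital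
C*-algebra `B`. -/
def CCR.lift (V : E → B) (hV : IsWeylSystem V) : CCR E →⋆ₐ[ℂ] B where
  toFun := CCR.liftFun V
  map_one' := CCR.liftFun_one hV
  map_mul' := CCR.liftFun_mul hV
  map_zero' := by rw [← CCR.of_zero, CCR.liftFun_of hV, map_zero]
  map_add' := CCR.liftFun_add hV
  commutes' c := by
    rw [Algebra.algebraMap_eq_smul_one, Algebra.algebraMap_eq_smul_one, CCR.liftFun_smul hV,
      CCR.liftFun_one hV]
  map_star' := CCR.liftFun_star hV

theorem CCR.lift_W (hV : IsWeylSystem V) (x : E) : CCR.lift V hV (W x) = V x :=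
  (CCR.liftFun_of hV (Alg.W x)).trans (Alg.linLift_W V x)

theorem CCR.continuous_lift (hV : IsWeylSystem V) : Continuous (CCR.lift V hV) :=
  CCR.continuous_liftFun

theorem CCR.lift_unique (hV : IsWeylSystem V) (f : CCR E →⋆ₐ[ℂ] B) (hf : ∀ x, f (W x) = V x) :
    f = CCR.lift V hV := by
  ext a
  refine CCR.mem_of_W_mem (StarAlgHom.equalizer f (CCR.lift V hV)) ?_ ?_ a
  · exact isClosed_eq (AddMonoidHomClass.continuous_of_bound f 1 fun a => by
      simpa using NonUnitalStarAlgHom.norm_apply_le f a) (CCR.continuous_lift hV)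
  · intro x
    exact (hf x).trans (CCR.lift_W hV x).symm

variable {F : Type v} [NormedAddCommGroup F] [InnerProductSpace ℂ F]

theorem isWeylSystem_comp (S : E →ₗᵢ[ℂ] F) : IsWeylSystem (fun x : E => W (S x)) where
  map_zero := by rw [map_zero, W_zero]
  star_eq x := by rw [star_W, map_neg]
  mul_eq x y := by
    rw [W_mul, map_add, phase, phase, sympl, sympl, S.inner_map_map]

/-- The `*`-homomorphism `W(x) ↦ W(S x)` induced by an isometry `S`. -/
def CCR.map (S : E →ₗᵢ[ℂ] F) : CCR E →⋆ₐ[ℂ] CCR F :=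
  CCR.lift (fun x : E => W (S x)) (isWeylSystem_comp S)

theorem CCR.map_W (S : E →ₗᵢ[ℂ] F) (x : E) : CCR.map S (W x) = W (S x) :=
  CCR.lift_W (isWeylSystem_comp S) x

theorem CCR.continuous_map (S : E →ₗᵢ[ℂ] F) : Continuous (CCR.map S) :=
  CCR.continuous_lift (isWeylSystem_comp S)

end CCR

/-! ## States -/

/-- A state on a unital complex `*`-algebra: a positive linear functional `f` with `f 1 = 1`.
On a unital C*-algebra these are the positive linear functionals of norm one. -/
structure State (A : Type*) [Ring A] [StarRing A] [Algebra ℂ A] where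
  toLinearMap : A →ₗ[ℂ] ℂ
  nonneg' : ∀ a : A, 0 ≤ toLinearMap (star a * a)
  map_one' : toLinearMap 1 = 1

instance {A : Type*} [Ring A] [StarRing A] [Algebra ℂ A] : CoeFun (State A) (fun _ => A → ℂ) :=
  ⟨fun f => f.toLinearMap⟩

/-- The function `G_φ(z) = φ(W(z))` of a state `φ` on the CCR algebra of `ℂ`. -/
def charFn (φ : State (CCR ℂ)) (z : ℂ) : ℂ := φ (W z)

/-! ## Localized operators, the algebra `𝔅₀`, product states and rotatable states -/

section Local

variable {H : Type u} [NormedAddCommGroup H] [InnerProductSpace ℂ H] (e : HilbertBasis ℤ ℂ H)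

/-- The dense subspace `H₀` of the vectors with finitely many non-zero Fourier coefficients. -/
def finiteVectors : Submodule ℂ H := Submodule.span ℂ (Set.range fun i : ℤ => e i)

/-- `𝔅₀`: the C*-subalgebra of `CCR(H)` generated by the `W(x)`, `x ∈ H₀`. -/
def B0 : StarSubalgebra ℂ (CCR H) :=
  (StarAlgebra.adjoin ℂ (W '' (finiteVectors e : Set H))).topologicalClosure

theorem isClosed_B0 : IsClosed (B0 e : Set (CCR H)) := StarSubalgebra.isClosed_topologicalClosure _

instance : CStarAlgebra (B0 e) := StarSubalgebra.cstarAlgebra (B0 e) (h_closed := isClosed_B0 e)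

theorem W_mem_B0 {x : H} (hx : x ∈ finiteVectors e) : W x ∈ B0 e :=
  StarSubalgebra.le_topologicalClosure _ (StarAlgebra.subset_adjoin ℂ _ ⟨x, hx, rfl⟩)

/-- The isometric embedding `z ↦ z e_k` of `ℂ` onto the `k`-th coordinate axis. -/
def coordIsometry (k : ℤ) : ℂ →ₗᵢ[ℂ] H :=
  LinearIsometry.toSpanSingleton ℂ H (e.orthonormal.norm_eq_one k)

theorem coordIsometry_mem (k : ℤ) (z : ℂ) : coordIsometry e k z ∈ finiteVectors e :=
  Submodule.smul_mem _ z (Submodule.subset_span ⟨k, rfl⟩)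

/-- The `k`-th embedding `i_k : 𝔄 → 𝔅₀` of the CCR algebra `𝔄` of `ℂ`, `W(z) ↦ W(z e_k)`. Under
the isomorphism of `𝔅₀` with the infinite tensor product `⨂_ℤ 𝔄` it is
`a ↦ ⋯ ⊗ 1 ⊗ a ⊗ 1 ⊗ ⋯` with `a` in the `k`-th place. -/
def siteEmb (k : ℤ) : CCR ℂ →⋆ₐ[ℂ] B0 e :=
  StarAlgHom.codRestrict (CCR.map (coordIsometry e k)) (B0 e) fun a =>
    CCR.mem_of_W_mem (StarSubalgebra.comap (CCR.map (coordIsometry e k)) (B0 e))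
      ((isClosed_B0 e).preimage (CCR.continuous_map _))
      (fun z => by
        rw [StarSubalgebra.mem_comap, CCR.map_W]
        exact W_mem_B0 e (coordIsometry_mem e k z)) a

/-- `ω = ⨂_ℤ φ`: the state `ω` on `𝔅₀` takes the value `φ(a_{k₁}) ⋯ φ(a_{kₙ})` on the localized
tensor `i_{k₁}(a_{k₁}) ⋯ i_{kₙ}(a_{kₙ})`, for distinct sites `k₁, …, kₙ`. -/
def IsProductState (φ : State (CCR ℂ)) (ω : State (B0 e)) : Prop :=
  ∀ (l : List ℤ) (a : ℤ → CCR ℂ), l.Nodup →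
    ω ((l.map fun k => siteEmb e k (a k)).prod) = (l.map fun k => φ (a k)).prod

/-- Membership in the group of the unitaries `U` of `H` such that `U e_i = e_i` for all but
finitely many `i`. -/
def IsLocalizedUnitary (U : H ≃ₗᵢ[ℂ] H) : Prop :=
  ∃ N : ℕ, ∀ i : ℤ, (N : ℤ) < |i| → U (e i) = e i

/-- Membership in the group of the localized unitaries all of whose matrix entries
`⟨O e_i, e_j⟩` are real. -/
structure IsLocalizedOrthogonal (O : H ≃ₗᵢ[ℂ] H) : Prop where
  localized : IsLocalizedUnitary e O
  real : ∀ i j : ℤ, (inner ℂ (e j) (O (e i))).im = 0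

variable {e}

theorem IsLocalizedUnitary.map_mem {U : H ≃ₗᵢ[ℂ] H} (hU : IsLocalizedUnitary e U) {x : H}
    (hx : x ∈ finiteVectors e) : U x ∈ finiteVectors e := by
  obtain ⟨N, hN⟩ := hU
  suffices h : finiteVectors e ≤ (finiteVectors e).comap (U.toLinearEquiv : H →ₗ[ℂ] H) from h hx
  refine Submodule.span_le.2 ?_
  rintro _ ⟨i, rfl⟩
  change U (e i) ∈ finiteVectors e
  have h0 : ∀ j ∉ Finset.Icc (-(N : ℤ)) N, e.repr (U (e i)) j • e j = 0 ∨ i = j := by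
    intro j hj
    have hj' : (N : ℤ) < |j| := by
      by_contra! hle
      exact hj (Finset.mem_Icc.2 (abs_le.1 hle))
    by_cases hij : i = j
    · exact Or.inr hij
    · left
      rw [e.repr_apply_apply, ← hN j hj', U.inner_map_map, e.orthonormal.2 (Ne.symm hij),
        zero_smul]
  by_cases hi : (N : ℤ) < |i|
  · rw [hN i hi]
    exact Submodule.subset_span ⟨i, rfl⟩
  · have hs : HasSum (fun j => e.repr (U (e i)) j • e j) (U (e i)) := e.hasSum_repr _
    have hf : U (e i) = ∑ j ∈ Finset.Icc (-(N : ℤ)) N, e.repr (U (e i)) j • e j := by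
      refine hs.unique (hasSum_sum_of_ne_finset_zero fun j hj => ?_)
      rcases h0 j hj with h | h
      · exact h
      · subst h
        exact absurd (Finset.mem_Icc.2 (abs_le.1 (not_lt.1 hi))) hj
    rw [hf]
    exact Submodule.sum_mem _ fun j _ =>
      Submodule.smul_mem _ _ (Submodule.subset_span ⟨j, rfl⟩)

theorem IsLocalizedUnitary.map_mem_B0 {U : H ≃ₗᵢ[ℂ] H} (hU : IsLocalizedUnitary e U)
    {a : CCR H} (ha : a ∈ B0 e) : CCR.map U.toLinearIsometry a ∈ B0 e := by
  suffices h : B0 e ≤ StarSubalgebra.comap (CCR.map U.toLinearIsometry) (B0 e) from h ha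
  refine StarSubalgebra.topologicalClosure_minimal (StarAlgebra.adjoin_le ?_)
    ((isClosed_B0 e).preimage (CCR.continuous_map _))
  rintro _ ⟨x, hx, rfl⟩
  rw [SetLike.mem_coe, StarSubalgebra.mem_comap, CCR.map_W]
  exact W_mem_B0 e (hU.map_mem hx)

/-- The restriction to `𝔅₀` of the automorphism `ρ_U : W(x) ↦ W(U x)` of `CCR(H)`. -/
def rho (U : H ≃ₗᵢ[ℂ] H) (hU : IsLocalizedUnitary e U) : B0 e →⋆ₐ[ℂ] B0 e :=
  StarAlgHom.codRestrict ((CCR.map U.toLinearIsometry).comp (B0 e).subtype) (B0 e)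
    fun a => hU.map_mem_B0 a.2

/-- A state on `𝔅₀` is rotatable if it is invariant under `ρ_O` for all `O` in the group of the
localized orthogonal transformations. -/
def IsRotatable (ω : State (B0 e)) : Prop :=
  ∀ (O : H ≃ₗᵢ[ℂ] H) (hO : IsLocalizedOrthogonal e O) (a : B0 e), ω (rho O hO.localized a) = ω a

end Local

end Weyl

end

namespace Weyl

/-! ## Multiplicative functions on the half-line -/

/-! This is Maxwell's characterization of the Gaussian, without continuity. If `r ^ 2 = a ^ 2 + b ^
2`, some real orthogonal map of the plane of `e 0` and `e 1` carries `r e₀` to `a e₀ + b e₁`.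
Rotatability and the product property then give `G(a) G(b) = G(r)` on the real line
(`IsProductState.charFn_mul`). Only this plane is needed, and in it only reflections.

Taking `b = 0` shows that `G(t)` depends on `t ^ 2` alone, so `f(s) = G(√s)` satisfies `f(s + t) =
f(s) f(t)` on the half-line. Evenness and positivity of the state make `f` real and at most one
(`charFn_im_and_re_le`). Since nothing makes `t ↦ W(t)` continuous, this bound is what excludes
pathological solutions: a nowhere zero `f` has a nonpositive additive logarithm, which is monotone
and hence linear, and this is the Gaussian case. If `f` has a zero, it vanishes on all positive
reals; this is the indicator case. -/

theorem eq_mul_of_additive_of_nonpos {L : ℝ → ℝ}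
    (hadd : ∀ s t, 0 ≤ s → 0 ≤ t → L (s + t) = L s + L t) (hL : ∀ s, 0 ≤ s → L s ≤ 0)
    {x : ℝ} (hx : 0 ≤ x) : L x = x * L 1 := by
  have hmono : ∀ s t, 0 ≤ s → s ≤ t → L t ≤ L s := fun s t hs hst => by
    have h := hadd s (t - s) hs (sub_nonneg.2 hst)
    rw [add_sub_cancel] at h
    linarith [hL (t - s) (sub_nonneg.2 hst)]
  have h0 : L 0 = 0 := by
    have h := hadd 0 0 le_rfl le_rfl
    rw [add_zero] at h
    linarith
  have hnat : ∀ (n : ℕ) (s : ℝ), 0 ≤ s → L (n * s) = n * L s := fun n s hs => by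
    induction n with
    | zero => simp [h0]
    | succ n ih =>
      push_cast
      rw [add_mul, one_mul, hadd _ _ (by positivity) hs, ih]
      ring
  -- With `m = ⌊n x⌋`, monotonicity puts `n L(x) = L(n x)` between `(m + 1) L(1)` and `m L(1)`. The
  -- number `n x L(1)` lies in the same interval, whose length `-L(1)` does not depend on `n`, so
  -- the Archimedean property forces equality.
  have hbound : ∀ n : ℕ, n * |L x - x * L 1| ≤ -L 1 := fun n => by
    have hnx : 0 ≤ n * x := by positivity
    have hlo := hmono _ _ (Nat.cast_nonneg _) (Nat.floor_le hnx)
    have hhi := hmono _ _ hnx (Nat.lt_floor_add_one ((n : ℝ) * x)).le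
    have h1 := hnat ⌊(n : ℝ) * x⌋₊ 1 zero_le_one
    have h2 := hnat (⌊(n : ℝ) * x⌋₊ + 1) 1 zero_le_one
    push_cast at h2
    rw [mul_one] at h1 h2
    rw [hnat n x hx] at hlo hhi
    have hf := Nat.floor_le hnx
    have hf' := (Nat.lt_floor_add_one ((n : ℝ) * x)).le
    have hL1 := hL 1 zero_le_one
    rw [← Nat.abs_cast n, ← abs_mul, abs_le]
    constructor <;> nlinarith
  by_contra hne
  obtain ⟨n, hn⟩ := exists_nat_gt (-L 1 / |L x - x * L 1|)
  rw [div_lt_iff₀ (abs_pos.2 (sub_ne_zero.2 hne))] at hn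
  exact absurd (hbound n) (not_le.2 hn)

/-- A multiplicative function on the half-line that is bounded by one vanishes on the positive
reals or is a decaying exponential. -/
theorem eq_zero_or_eq_exp_of_multiplicative {f : ℝ → ℝ}
    (hmul : ∀ s t, 0 ≤ s → 0 ≤ t → f (s + t) = f s * f t) (hf : ∀ s, 0 ≤ s → f s ≤ 1) :
    (∀ s, 0 < s → f s = 0) ∨ ∃ c : ℝ, 0 ≤ c ∧ ∀ s, 0 ≤ s → f s = Real.exp (-(c * s)) := by
  have hnonneg : ∀ s, 0 ≤ s → 0 ≤ f s := fun s hs => by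
    have h := hmul (s / 2) (s / 2) (by positivity) (by positivity)
    rw [add_halves] at h
    rw [h]
    exact mul_self_nonneg _
  by_cases hz : ∃ s, 0 ≤ s ∧ f s = 0
  · left
    obtain ⟨s, hs, hfs⟩ := hz
    intro t ht
    -- A zero at a point passes to its half, because the value there is the square of the value at
    -- the half. Zeros thus occur arbitrarily close to 0, and each one annihilates `f` at every
    -- larger argument.
    have hpow : ∀ n : ℕ, f (s / 2 ^ n) = 0 := fun n => by
      induction n with
      | zero => simpa using hfs
      | succ n ih =>
        have h := hmul (s / 2 ^ (n + 1)) (s / 2 ^ (n + 1)) (by positivity) (by positivity)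
        rw [show s / 2 ^ (n + 1) + s / 2 ^ (n + 1) = s / 2 ^ n by field_simp; ring, ih] at h
        exact mul_self_eq_zero.1 h.symm
    obtain ⟨n, hn⟩ := pow_unbounded_of_one_lt (s / t) (one_lt_two : (1 : ℝ) < 2)
    have hlt : s / 2 ^ n < t := by
      rw [div_lt_iff₀ ht] at hn
      rw [div_lt_iff₀ (by positivity)]
      linarith
    have h := hmul (s / 2 ^ n) (t - s / 2 ^ n) (by positivity) (by linarith)
    rwa [add_sub_cancel, hpow, zero_mul] at h
  · right
    push Not at hz
    have hpos : ∀ s, 0 ≤ s → 0 < f s := fun s hs => (hnonneg s hs).lt_of_ne' (hz s hs)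
    refine ⟨-Real.log (f 1), ?_, fun s hs => ?_⟩
    · linarith [Real.log_nonpos (hnonneg 1 zero_le_one) (hf 1 zero_le_one)]
    · have h := eq_mul_of_additive_of_nonpos (L := fun s => Real.log (f s))
        (fun s t hs ht => by
          rw [hmul s t hs ht, Real.log_mul (hz s hs) (hz t ht)])
        (fun s hs => Real.log_nonpos (hnonneg s hs) (hf s hs)) hs
      rw [← Real.exp_log (hpos s hs), h]
      congr 1
      ring

/-! ## Positivity of states on Weyl unitaries -/

theorem charFn_zero (φ : State (CCR ℂ)) : charFn φ 0 = 1 := by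
  rw [charFn, W_zero, φ.map_one']

/-- Expand `φ(a* a) ≥ 0` for `a = 1 + ε W(z)`. The two diagonal terms contribute 2 since `ε W(z)` is
unitary. -/
theorem charFn_positivity (φ : State (CCR ℂ)) (z : ℂ) {ε : ℂ} (hε : star ε * ε = 1) :
    0 ≤ 2 + (ε * charFn φ z + star ε * charFn φ (-z)) := by
  have h := φ.nonneg' (1 + ε • W z)
  have hexp : star (1 + ε • W z) * (1 + ε • W z)
      = (2 : ℂ) • (1 : CCR ℂ) + (ε • W z + star ε • W (-z)) := by
    rw [star_add, star_one, star_smul, star_W, add_mul, mul_add, mul_add, smul_mul_smul_comm,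
      W_mul, phase_neg_self, hε, neg_add_cancel, W_zero, one_mul, one_mul, mul_one, one_smul,
      one_smul, two_smul]
    abel
  rw [hexp, map_add, map_add, map_smul, map_smul, map_smul, φ.map_one'] at h
  simpa [charFn] using h

/-- The choice `ε = -1` gives `0 ≤ 2 - 2 G(z)`. In the order of `ℂ` this also says that the
imaginary part vanishes, so one inequality yields both claims. -/
theorem charFn_im_and_re_le (φ : State (CCR ℂ)) {z : ℂ} (hz : charFn φ (-z) = charFn φ z) :
    (charFn φ z).im = 0 ∧ (charFn φ z).re ≤ 1 := by
  have h := charFn_positivity φ z (ε := -1) (by simp)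
  rw [hz, Complex.le_def] at h
  obtain ⟨h1, h2⟩ := h
  simp at h1 h2
  constructor <;> linarith

/-! ## Rotations in a coordinate plane -/

section Rotation

variable {H : Type u} [NormedAddCommGroup H] [InnerProductSpace ℂ H] {e : HilbertBasis ℤ ℂ H}

theorem inner_basis_plane (p q : ℝ) (j : ℤ) :
    inner ℂ (e j) ((p : ℂ) • e 0 + (q : ℂ) • e 1)
      = (((if j = 0 then p else 0) + (if j = 1 then q else 0) : ℝ) : ℂ) := by
  have h := orthonormal_iff_ite.1 e.orthonormal
  rw [inner_add_right, inner_smul_right, inner_smul_right, h, h]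
  split_ifs <;> simp

theorem norm_sq_plane (p q : ℝ) : ‖(p : ℂ) • e 0 + (q : ℂ) • e 1‖ ^ 2 = p ^ 2 + q ^ 2 := by
  have h : ((‖(p : ℂ) • e 0 + (q : ℂ) • e 1‖ ^ 2 : ℝ) : ℂ) = ((p ^ 2 + q ^ 2 : ℝ) : ℂ) := by
    rw [Complex.ofReal_pow]
    refine (inner_self_eq_norm_sq_to_K (𝕜 := ℂ) ((p : ℂ) • e 0 + (q : ℂ) • e 1)).symm.trans ?_
    nth_rewrite 1 [inner_add_left]
    rw [inner_smul_left, inner_smul_left, inner_basis_plane, inner_basis_plane]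
    simp
    ring
  exact_mod_cast h

/-- The reflection in the hyperplane orthogonal to `p e₀ + q e₁`. -/
noncomputable def planeReflection (e : HilbertBasis ℤ ℂ H) (p q : ℝ) : H ≃ₗᵢ[ℂ] H :=
  (ℂ ∙ ((p : ℂ) • e 0 + (q : ℂ) • e 1)).reflection.trans (LinearIsometryEquiv.neg ℂ)

/-- The formula needs no case distinction: for `p = q = 0` the subtracted vector is zero and the map
is the identity. -/
theorem planeReflection_apply (p q : ℝ) (x : H) :
    planeReflection e p q x = x -
      (2 * (inner ℂ ((p : ℂ) • e 0 + (q : ℂ) • e 1) x / ((p ^ 2 + q ^ 2 : ℝ) : ℂ))) •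
        ((p : ℂ) • e 0 + (q : ℂ) • e 1) := by
  rw [planeReflection, LinearIsometryEquiv.trans_apply, Submodule.reflection_singleton_apply,
    ← norm_sq_plane (e := e), Complex.ofReal_pow]
  generalize (p : ℂ) • e 0 + (q : ℂ) • e 1 = v
  rw [two_mul, add_smul, ← two_smul ℕ]
  exact neg_sub _ _

/-- Every `e i` with `i ≠ 0, 1` is orthogonal to `p e₀ + q e₁`, hence fixed. The matrix entries are
rational expressions in the real numbers `p`, `q` and Kronecker deltas. -/
theorem planeReflection_isLocalizedOrthogonal (p q : ℝ) :
    IsLocalizedOrthogonal e (planeReflection e p q) where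
  localized := ⟨1, fun i hi => by
    have h0 : i ≠ 0 := by rintro rfl; simp at hi
    have h1 : i ≠ 1 := by rintro rfl; simp at hi
    rw [planeReflection_apply, ← inner_conj_symm, inner_basis_plane]
    simp [h0, h1]⟩
  real i j := by
    rw [planeReflection_apply, ← inner_conj_symm _ (e i), inner_basis_plane, Complex.conj_ofReal,
      inner_sub_right, inner_smul_right, inner_basis_plane,
      orthonormal_iff_ite.1 e.orthonormal j i,
      show (if j = i then (1 : ℂ) else 0) = ((if j = i then 1 else 0 : ℝ) : ℂ) by
        split_ifs <;> simp,
      ← Complex.ofReal_div, ← Complex.ofReal_ofNat, ← Complex.ofReal_mul, ← Complex.ofReal_mul,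
      ← Complex.ofReal_sub, Complex.ofReal_im]

/-- The reflection that exchanges two vectors of the plane of the same length. -/
theorem planeReflection_sub {r a b : ℝ} (h : r ^ 2 = a ^ 2 + b ^ 2) :
    planeReflection e (r - a) (-b) ((r : ℂ) • e 0) = (a : ℂ) • e 0 + (b : ℂ) • e 1 := by
  have hin : inner ℂ (((r - a : ℝ) : ℂ) • e 0 + ((-b : ℝ) : ℂ) • e 1) ((r : ℂ) • e 0)
      = ((r * (r - a) : ℝ) : ℂ) := by
    rw [inner_smul_right, ← inner_conj_symm, inner_basis_plane, Complex.conj_ofReal]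
    simp
  rw [planeReflection_apply, hin]
  -- In the degenerate case the two vectors coincide and the reflection is the identity.
  by_cases hv : (r - a) ^ 2 + (-b) ^ 2 = 0
  · have h1 : r - a = 0 := by nlinarith [sq_nonneg (r - a), sq_nonneg (-b)]
    have h2 : b = 0 := by nlinarith [sq_nonneg (r - a), sq_nonneg (-b)]
    obtain rfl : r = a := by linarith
    simp [h2]
  -- By `h` the denominator is `2 r (r - a)`, so the reflection subtracts exactly the difference of
  -- the two vectors.
  · have hc : (2 : ℂ) * (((r * (r - a) : ℝ) : ℂ) / (((r - a) ^ 2 + (-b) ^ 2 : ℝ) : ℂ)) = 1 := by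
      have hr : 2 * (r * (r - a) / ((r - a) ^ 2 + (-b) ^ 2)) = 1 := by
        rw [← mul_div_assoc, div_eq_one_iff_eq hv]
        linear_combination h
      exact_mod_cast congrArg (fun x : ℝ => (x : ℂ)) hr
    rw [hc, one_smul]
    push_cast
    module

end Rotation

/-! ## Product states -/

section Product

variable {H : Type u} [NormedAddCommGroup H] [InnerProductSpace ℂ H] {e : HilbertBasis ℤ ℂ H}
  {φ : State (CCR ℂ)} {ω : State (B0 e)}

theorem plane_mem_finiteVectors (e : HilbertBasis ℤ ℂ H) (a b : ℝ) :
    (a : ℂ) • e 0 + (b : ℂ) • e 1 ∈ finiteVectors e :=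
  add_mem (coordIsometry_mem e 0 a) (coordIsometry_mem e 1 b)

/-- Since `e 0` and `e 1` are orthogonal, the phase is trivial and `W(a e₀ + b e₁)` is the product
of the site operators `W(a e₀)` and `W(b e₁)`. -/
theorem IsProductState.apply_W_plane (hω : IsProductState e φ ω) (a b : ℝ) :
    ω ⟨W ((a : ℂ) • e 0 + (b : ℂ) • e 1), W_mem_B0 e (plane_mem_finiteVectors e a b)⟩
      = charFn φ a * charFn φ b := by
  have h := hω [0, 1] (fun k => W (if k = 0 then (a : ℂ) else (b : ℂ))) (by simp)
  simp only [List.map_cons, List.map_nil, List.prod_cons, List.prod_nil, mul_one, if_true,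
    one_ne_zero, if_false] at h
  rw [charFn, charFn, ← h]
  congr 1
  apply Subtype.ext
  change _ = CCR.map (coordIsometry e 0) (W (a : ℂ)) * CCR.map (coordIsometry e 1) (W (b : ℂ))
  rw [CCR.map_W, CCR.map_W, W_mul]
  have hph : phase (coordIsometry e 0 (a : ℂ)) (coordIsometry e 1 (b : ℂ)) = 1 := by
    have hs : sympl (coordIsometry e 0 (a : ℂ)) (coordIsometry e 1 (b : ℂ)) = 0 := by
      change (inner ℂ ((b : ℂ) • e 1) ((a : ℂ) • e 0)).im = 0
      rw [inner_smul_left, inner_smul_right, e.orthonormal.2 one_ne_zero]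
      simp
    simp [phase, hs]
  rw [hph, one_smul]
  rfl

/-- Both sides are values of `ω` at Weyl unitaries of plane vectors of equal length, which a
localized orthogonal reflection exchanges. -/
theorem IsProductState.charFn_mul (hω : IsProductState e φ ω) (hrot : IsRotatable ω)
    {r a b : ℝ} (h : r ^ 2 = a ^ 2 + b ^ 2) :
    charFn φ a * charFn φ b = charFn φ r := by
  have hO := planeReflection_isLocalizedOrthogonal (e := e) (r - a) (-b)
  -- Reading `r e₀` as `r e₀ + 0 e₁` lets `apply_W_plane` evaluate both sides.
  have hr : charFn φ r = charFn φ r * charFn φ ((0 : ℝ) : ℂ) := by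
    rw [Complex.ofReal_zero, charFn_zero, mul_one]
  rw [hr, ← hω.apply_W_plane, ← hω.apply_W_plane]
  refine Eq.trans ?_ (hrot _ hO _)
  congr 1
  apply Subtype.ext
  change _ = CCR.map (planeReflection e (r - a) (-b)).toLinearIsometry
    (W ((r : ℂ) • e 0 + ((0 : ℝ) : ℂ) • e 1))
  rw [CCR.map_W]
  refine congrArg W ?_
  simpa using (planeReflection_sub (e := e) h).symm

end Product

end Weyl

theorem proposition3p6 {H : Type*} [NormedAddCommGroup H] [InnerProductSpace ℂ H]
    [CompleteSpace H] (e : HilbertBasis ℤ ℂ H)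
    (φ : Weyl.State (Weyl.CCR ℂ)) (ω : Weyl.State (Weyl.B0 e))
    (hω : Weyl.IsProductState e φ ω) (hrot : Weyl.IsRotatable ω) :
    (∀ t : ℝ, Weyl.charFn φ (t : ℂ) = Set.indicator {(0 : ℝ)} (fun _ => (1 : ℂ)) t) ∨
      ∃ σ2 : ℝ, 0 ≤ σ2 ∧
        ∀ t : ℝ, Weyl.charFn φ (t : ℂ) = ((Real.exp (-(σ2 * t ^ 2 / 2)) : ℝ) : ℂ) := by
  have hmul : ∀ r a b : ℝ, r ^ 2 = a ^ 2 + b ^ 2 →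
      Weyl.charFn φ a * Weyl.charFn φ b = Weyl.charFn φ r := fun _ _ _ h =>
    hω.charFn_mul hrot h
  have hzero : Weyl.charFn φ ((0 : ℝ) : ℂ) = 1 := by
    rw [Complex.ofReal_zero, Weyl.charFn_zero]
  have hsq : ∀ s t : ℝ, s ^ 2 = t ^ 2 → Weyl.charFn φ s = Weyl.charFn φ t := fun s t h => by
    rw [← hmul t s 0 (by rw [h]; ring), hzero, mul_one]
  have hbd : ∀ t : ℝ, (Weyl.charFn φ t).im = 0 ∧ (Weyl.charFn φ t).re ≤ 1 := fun t =>
    Weyl.charFn_im_and_re_le φ (by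
      rw [← Complex.ofReal_neg]
      exact hsq _ _ (neg_sq t))
  -- This is `G(t) = f(t ^ 2)` with `f(s) = Re G(√s)`, the function to which the half-line dichotomy
  -- is applied.
  have hreal : ∀ t : ℝ, Weyl.charFn φ t = (((Weyl.charFn φ (√(t ^ 2) : ℝ)).re : ℝ) : ℂ) :=
    fun t => by
      rw [hsq (√(t ^ 2)) t (Real.sq_sqrt (sq_nonneg t))]
      exact Complex.ext rfl (hbd t).1
  rcases Weyl.eq_zero_or_eq_exp_of_multiplicative
      (f := fun s => (Weyl.charFn φ (√s : ℝ)).re)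
      (fun s t hs ht => by
        rw [← hmul (√(s + t)) (√s) (√t) (by
          rw [Real.sq_sqrt hs, Real.sq_sqrt ht, Real.sq_sqrt (add_nonneg hs ht)]),
          Complex.mul_re, (hbd _).1, zero_mul, sub_zero])
      (fun s _ => (hbd _).2) with h | ⟨c, hc, h⟩
  · left
    intro t
    by_cases ht : t = 0
    · subst ht
      simp [Weyl.charFn_zero]
    · rw [hreal, h (t ^ 2) (by positivity)]
      simp [ht]
  · right
    -- The variance is `2 c` because `f(t ^ 2) = exp(-c t ^ 2)`.
    refine ⟨2 * c, by positivity, fun t => ?_⟩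
    rw [hreal, h (t ^ 2) (sq_nonneg t)]
    congr 3
    ring
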